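/- Let $\mathbb F=\mathbb R$ or $\mathbb C$, and view $\mathbb F^n\subset\mathbb F^{n+1}$ by the canonical inclusion, each $\mathbb F^n$ with its standard inner product. Let $G_p^\infty=\bigcup_n G_p(\mathbb F^n)$ be the infinite Grassmannian of all $p$-dimensional subspaces of all the $\mathbb F^n$, let $G^\infty=\bigcup_p G_p^\infty$ be the infinite full Grassmannian, and for $W\in G^\infty$ let $G_p(W)$ be the set of $p$-dimensional subspaces of $W$ (empty if $p>\dim W$). For nonzero $V,W\in G^\infty$ with $p=\dim V$, $q=\dim W$, $m=\min\{p,q\}$, the principal angles of $V$ and $W$ are the uniquely determined numbers $0\le\theta_1\le\dots\le\theta_m\le\frac\pi2$ for which there are orthonormal bases $(e_1,\dots,e_p)$ of $V$ and $(f_1,\dots,f_q)$ of $W$ with $\langle e_i,f_j\rangle=0$ for $i\ne j$ and $\langle e_i,f_i\rangle=\cos\theta_i$ for $1\le i\le m$. **Theorem.** For $p=0,1,2,\dots$ let $d_p:G_p^\infty\times G_p^\infty\to[0,\infty]$ be a metric (the value $\infty$ is allowed), and for $p\ge 1$ let $f_p$ be a $[0,\infty]$-valued function of the tuples $0\le\theta_1\le\dots\le\theta_p\le\frac\pi2$,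 nondecreasing in the componentwise order, such that 1. $d_p(V,W)=f_p(\theta_1,\dots,\theta_p)$ for all $p\ge1$ and $V,W\in G_p^\infty$ with principal angles $\theta_1,\dots,\theta_p$; 2. $f_q(0,\dots,0,\theta_1,\dots,\theta_p)=f_p(\theta_1,\dots,\theta_p)$ for all $q>p\ge1$ and all $0\le\theta_1\le\dots\le\theta_p\le\frac\pi2$. Let $\operatorname{diam}G_p^\infty=\sup\{d_p(V,W):V,W\in G_p^\infty\}\in[0,\infty]$, and for $V,W\in G^\infty$ with $p=\dim V$ let $$d(V,W)=\inf\nolimits_p\{d_p(V,W'):W'\in G_p(W)\},$$ where $\inf_p$ is the infimum taken in the ordered set $[0,\operatorname{diam}G_p^\infty]$, so that $\inf_p\emptyset=\operatorname{diam}G_p^\infty$. Then $d:G^\infty\times G^\infty\to[0,\infty]$ is an asymmetric metric: for all $U,V,W\in G^\infty$, $$d(V,W)=d(W,V)=0\iff V=W,\qquad d(U,W)\le d(U,V)+d(V,W).$$ Moreover, for $V,W\in G^\infty$ with $p=\dim V$ and $q=\dim W$, $$d(V,W)=\begin{cases} f_p(\theta_1,\dots,\theta_p) & \text{if } 0<p\le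 q,\text{ where }\theta_1,\dots,\theta_p\text{ are the principal angles of }V\text{ and }W,\\ \operatorname{diam}G_p^\infty & \text{otherwise.}\end{cases}$$ -/

import Mathlib

open scoped ENNReal

noncomputable section

namespace InfGrassmannian

/-- A metric with values in `[0, ∞]`. -/
structure IsMetric {M : Type*} (d : M → M → ℝ≥0∞) : Prop where
  eq_zero_iff : ∀ x y, d x y = 0 ↔ x = y
  symm : ∀ x y, d x y = d y x
  triangle : ∀ x y z, d x z ≤ d x y + d y z

/-- An asymmetric metric on a non-empty set: the separation condition
`d x y = d y x = 0 ↔ x = y` and the oriented triangle inequality. -/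
structure IsAsymmetricMetric {M : Type*} (d : M → M → ℝ≥0∞) : Prop where
  nonempty : Nonempty M
  separation : ∀ x y, (d x y = 0 ∧ d y x = 0) ↔ x = y
  triangle : ∀ x y z, d x z ≤ d x y + d y z

/-- The diameter `sup {d x y}`, in `[0, ∞]`. -/
def diam {M : Type*} (d : M → M → ℝ≥0∞) : ℝ≥0∞ := ⨆ x, ⨆ y, d x y

/-- The infimum of `S` taken in the ordered set `[0, D]`, that is, in the complete lattice
`Set.Iic D` of the elements of `[0, ∞]` that are at most `D`. In particular the infimum of the
empty set is `D`. -/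
def infIn (D : ℝ≥0∞) (S : Set ℝ≥0∞) : ℝ≥0∞ :=
  ((sInf {x : Set.Iic D | (x : ℝ≥0∞) ∈ S} : Set.Iic D) : ℝ≥0∞)

/-- The space of square-summable sequences in `𝕜`, which contains all the `𝕜ⁿ`, each with its
standard inner product, in a way compatible with the canonical inclusions `𝕜ⁿ ⊆ 𝕜ⁿ⁺¹`. -/
abbrev Ambient (𝕜 : Type*) [RCLike 𝕜] : Type _ := lp (fun _ : ℕ => 𝕜) 2

/-- The copy of `𝕜ⁿ` in the space of sequences: only the first `n` coordinates may be nonzero. -/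
def coordSpace (𝕜 : Type*) [RCLike 𝕜] (n : ℕ) : Submodule 𝕜 (Ambient 𝕜) where
  carrier := {x | ∀ k, n ≤ k → x k = 0}
  add_mem' := by
    intro a b ha hb k hk
    simp [ha k hk, hb k hk]
  zero_mem' := by
    intro k _
    simp
  smul_mem' := by
    intro c a ha k hk
    simp [ha k hk]

/-- The infinite full Grassmannian `G^∞ = ⋃ n, G(𝕜ⁿ)` of all subspaces of all the `𝕜ⁿ`. -/
def FullGr (𝕜 : Type*) [RCLike 𝕜] : Type _ :=
  {V : Submodule 𝕜 (Ambient 𝕜) // ∃ n, V ≤ coordSpace 𝕜 n}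

/-- The dimension of an element of `G^∞`. -/
def FullGr.dim {𝕜 : Type*} [RCLike 𝕜] (V : FullGr 𝕜) : ℕ := Module.finrank 𝕜 V.1

/-- The infinite Grassmannian `G_p^∞ = ⋃ n, G_p(𝕜ⁿ)` of all `p`-dimensional subspaces of all
the `𝕜ⁿ`. -/
def Gr (𝕜 : Type*) [RCLike 𝕜] (p : ℕ) : Type _ := {V : FullGr 𝕜 // V.dim = p}

/-- The tuples `0 ≤ θ₁ ≤ ⋯ ≤ θₘ ≤ π / 2`. -/
def angleTuples (m : ℕ) : Set (Fin m → ℝ) :=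
  {θ | Monotone θ ∧ ∀ i, θ i ∈ Set.Icc 0 (Real.pi / 2)}

/-- `θ = (θ₁, …, θₘ)` is the tuple of principal angles of the (nonzero, finite-dimensional)
subspaces `V` and `W`: `m = min (dim V) (dim W)`, `0 ≤ θ₁ ≤ ⋯ ≤ θₘ ≤ π / 2`, and there are
orthonormal bases `e` of `V` and `f` of `W` with `⟪eᵢ, fⱼ⟫ = 0` for `i ≠ j` and
`⟪eᵢ, fᵢ⟫ = cos θᵢ` for `1 ≤ i ≤ m`. -/
def IsPrincipalAngles {𝕜 E : Type*} [RCLike 𝕜] [NormedAddCommGroup E] [InnerProductSpace 𝕜 E]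
    (V W : Submodule 𝕜 E) {m : ℕ} (θ : Fin m → ℝ) : Prop :=
  m = min (Module.finrank 𝕜 V) (Module.finrank 𝕜 W) ∧ θ ∈ angleTuples m ∧
    ∃ (e : OrthonormalBasis (Fin (Module.finrank 𝕜 V)) 𝕜 V)
      (f : OrthonormalBasis (Fin (Module.finrank 𝕜 W)) 𝕜 W),
      (∀ (i : Fin (Module.finrank 𝕜 V)) (j : Fin (Module.finrank 𝕜 W)), (i : ℕ) ≠ (j : ℕ) →
        inner 𝕜 (e i : E) (f j : E) = 0) ∧
      (∀ (k : Fin m) (i : Fin (Module.finrank 𝕜 V)) (j : Fin (Module.finrank 𝕜 W)),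
        (i : ℕ) = (k : ℕ) → (j : ℕ) = (k : ℕ) →
        inner 𝕜 (e i : E) (f j : E) = ((Real.cos (θ k) : ℝ) : 𝕜))

/-- The function `d(V, W) = inf_p {d_p(V, W') : W' ∈ G_p(W)}` on `G^∞`, where `p = dim V` and the
infimum is taken in `[0, diam G_p^∞]`. -/
def asymExtension {𝕜 : Type*} [RCLike 𝕜] (d : ∀ p : ℕ, Gr 𝕜 p → Gr 𝕜 p → ℝ≥0∞)
    (V W : FullGr 𝕜) : ℝ≥0∞ :=
  infIn (diam (d V.dim)) {x | ∃ W' : Gr 𝕜 V.dim, W'.1.1 ≤ W.1 ∧ x = d V.dim ⟨V, rfl⟩ W'}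

end InfGrassmannian

end

/-! The engine is interlacing, `IsPrincipalAngles.le_of_le`. The squared cosines of the principal
angles are the eigenvalues of the quadratic form `‖P_W x‖²` on `V`, so a min-max dimension count
compares angles when `V` shrinks or `W` grows.

If `0 < dim V ≤ dim W`, shrinking `W` to some `W'` of dimension `dim V` can only raise the angles,
and the span of the first `dim V` principal vectors of `W` keeps them. As `f` is monotone, the
infimum is attained and equals `f` of the angles (`asymExtension_eq`).

For the triangle inequality with `dim U ≤ dim V ≤ dim W`, take an optimal `V' ≤ V` for `U`, then an
optimal `W' ≤ W` for `V'`, and use the triangle inequality of the metric in dimension `dim U`. The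
angles of `V'` and `W`, padded with zeros, lie below those of `V` and `W`, so `le_of_interlacing`
bounds the last term. If a dimension drops, some term on the right is a diameter, and `diam_le_diam`
suffices. -/

namespace InfGrassmannian

/-! ### Principal angles: interlacing, uniqueness, existence -/

section PrincipalAngles

variable {𝕜 E : Type*} [RCLike 𝕜] [NormedAddCommGroup E] [InnerProductSpace 𝕜 E]

theorem exists_orthonormalBasis_span {p : ℕ} {e : Fin p → E} (he : Orthonormal 𝕜 e) :
    ∃ b : OrthonormalBasis (Fin (Module.finrank 𝕜 (Submodule.span 𝕜 (Set.range e)))) 𝕜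
        (Submodule.span 𝕜 (Set.range e)),
      ∀ (i : Fin (Module.finrank 𝕜 (Submodule.span 𝕜 (Set.range e)))) (k : Fin p),
        (i : ℕ) = k → (b i : E) = e k := by
  have hp : Module.finrank 𝕜 (Submodule.span 𝕜 (Set.range e)) = p := by
    simpa using finrank_span_eq_card he.linearIndependent
  have : FiniteDimensional 𝕜 (Submodule.span 𝕜 (Set.range e)) :=
    FiniteDimensional.span_of_finite 𝕜 (Set.finite_range e)
  let e' : Fin p → Submodule.span 𝕜 (Set.range e) :=
    fun i => ⟨e i, Submodule.subset_span ⟨i, rfl⟩⟩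
  have he' : Orthonormal 𝕜 e' := by
    constructor
    · intro i
      exact he.1 i
    · intro i j hij
      exact he.2 hij
  have hspan : ⊤ ≤ Submodule.span 𝕜 (Set.range e') := by
    rw [top_le_iff]
    have := he'.linearIndependent.span_eq_top_of_card_eq_finrank' (by simp [hp])
    exact this
  refine ⟨(OrthonormalBasis.mk he' hspan).reindex (finCongr hp.symm), fun i k hik => ?_⟩
  have : (finCongr hp.symm).symm i = k := Fin.ext (by simpa using hik)
  rw [OrthonormalBasis.reindex_apply, this, OrthonormalBasis.coe_mk]

/-- Principal angles can be read off orthonormal families in the ambient space. -/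
theorem isPrincipalAngles_span {p q m : ℕ} (hm : m = min p q) {e : Fin p → E} {f : Fin q → E}
    (he : Orthonormal 𝕜 e) (hf : Orthonormal 𝕜 f) {θ : Fin m → ℝ} (hθ : θ ∈ angleTuples m)
    (hne : ∀ (i : Fin p) (j : Fin q), (i : ℕ) ≠ j → inner 𝕜 (e i) (f j) = 0)
    (heq : ∀ (k : Fin m) (i : Fin p) (j : Fin q), (i : ℕ) = k → (j : ℕ) = k →
      inner 𝕜 (e i) (f j) = ((Real.cos (θ k) : ℝ) : 𝕜)) :
    IsPrincipalAngles (Submodule.span 𝕜 (Set.range e)) (Submodule.span 𝕜 (Set.range f)) θ := by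
  have hp : Module.finrank 𝕜 (Submodule.span 𝕜 (Set.range e)) = p := by
    simpa using finrank_span_eq_card he.linearIndependent
  have hq : Module.finrank 𝕜 (Submodule.span 𝕜 (Set.range f)) = q := by
    simpa using finrank_span_eq_card hf.linearIndependent
  obtain ⟨b, hb⟩ := exists_orthonormalBasis_span he
  obtain ⟨c, hc⟩ := exists_orthonormalBasis_span hf
  refine ⟨by rw [hp, hq, hm], hθ, b, c, fun i j hij => ?_, fun k i j hi hj => ?_⟩
  · rw [hb i (Fin.cast hp i) rfl, hc j (Fin.cast hq j) rfl]
    exact hne _ _ hij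
  · rw [hb i (Fin.cast hp i) rfl, hc j (Fin.cast hq j) rfl]
    exact heq _ _ _ hi hj

theorem span_range_coe_orthonormalBasis {ι : Type*} [Fintype ι] {V : Submodule 𝕜 E}
    (b : OrthonormalBasis ι 𝕜 V) :
    Submodule.span 𝕜 (Set.range fun i => (b i : E)) = V := by
  have : (Set.range fun i => (b i : E)) = V.subtype '' Set.range b := by
    rw [← Set.range_comp]; rfl
  rw [this, Submodule.span_image, ← b.coe_toBasis, b.toBasis.span_eq, Submodule.map_top,
    Submodule.range_subtype]

theorem orthonormal_coe_orthonormalBasis {ι : Type*} [Fintype ι] {V : Submodule 𝕜 E}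
    (b : OrthonormalBasis ι 𝕜 V) : Orthonormal 𝕜 fun i => (b i : E) :=
  b.orthonormal.comp_linearIsometry V.subtypeₗᵢ

theorem norm_sq_sum_smul_of_orthonormal {ι : Type*} [Fintype ι] {v : ι → E} (hv : Orthonormal 𝕜 v)
    (a : ι → 𝕜) : ‖∑ i, a i • v i‖ ^ 2 = ∑ i, ‖a i‖ ^ 2 := by
  rw [@norm_sq_eq_re_inner 𝕜, hv.inner_sum a a Finset.univ, map_sum]
  refine Finset.sum_congr rfl fun i _ => ?_
  rw [RCLike.conj_mul, ← RCLike.ofReal_pow, RCLike.ofReal_re]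

/-- The projection sends each `e i` to `cos (θ i)` times the matching vector of `W`, so this form is
diagonal in `e`. This is what makes a min-max argument available. -/
theorem norm_sq_orthogonalProjectionOnto_eq_sum {V W : Submodule 𝕜 E} [FiniteDimensional 𝕜 W]
    {m : ℕ} {θ : Fin m → ℝ} (h : IsPrincipalAngles V W θ) (hm : Module.finrank 𝕜 V = m) :
    ∃ e : OrthonormalBasis (Fin m) 𝕜 V, ∀ x : V,
      ‖W.orthogonalProjectionOnto (x : E)‖ ^ 2 =
        ∑ i, Real.cos (θ i) ^ 2 * ‖inner 𝕜 (e i) x‖ ^ 2 := by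
  subst hm
  obtain ⟨hmin, hθ, e, f, hne, heq⟩ := h
  have hle : Module.finrank 𝕜 V ≤ Module.finrank 𝕜 W := by omega
  refine ⟨e, fun x => ?_⟩
  have hPe : ∀ i, W.orthogonalProjectionOnto (e i : E) =
      ((Real.cos (θ i) : ℝ) : 𝕜) • f (Fin.castLE hle i) := by
    intro i
    refine InnerProductSpace.ext_inner_left_basis f.toBasis fun j => ?_
    rw [f.coe_toBasis, Submodule.inner_orthogonalProjectionOnto_eq_of_mem_left, inner_smul_right,
      f.inner_eq_ite, ← inner_conj_symm]
    split_ifs with hj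
    · rw [heq i i j rfl (by simp [hj])]
      simp
    · rw [hne i j fun hij => hj (Fin.ext hij.symm)]
      simp
  have hPx : W.orthogonalProjectionOnto (x : E) =
      ∑ i, (inner 𝕜 (e i) x * ((Real.cos (θ i) : ℝ) : 𝕜)) • f (Fin.castLE hle i) := by
    conv_lhs => rw [← e.sum_repr' x]
    simp only [Submodule.coe_sum, Submodule.coe_smul, map_sum, map_smul, hPe, smul_smul]
  rw [hPx]
  refine (norm_sq_sum_smul_of_orthonormal
    (f.orthonormal.comp _ (Fin.castLE_injective hle)) _).trans ?_
  refine Finset.sum_congr rfl fun i _ => ?_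
  rw [norm_mul, mul_pow, RCLike.norm_ofReal, sq_abs, mul_comm]

theorem cos_sq_anti_of_mem_angleTuples {m : ℕ} {θ : Fin m → ℝ} (hθ : θ ∈ angleTuples m)
    {i j : Fin m} (hij : i ≤ j) : Real.cos (θ j) ^ 2 ≤ Real.cos (θ i) ^ 2 := by
  have hi := hθ.2 i
  have hj := hθ.2 j
  have hpi := Real.pi_pos
  have h0 : 0 ≤ Real.cos (θ j) :=
    Real.cos_nonneg_of_mem_Icc ⟨by linarith [hj.1], hj.2⟩
  exact pow_le_pow_left₀ h0
    (Real.cos_le_cos_of_nonneg_of_le_pi hi.1 (by linarith [hj.2]) (hθ.1 hij)) 2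

theorem norm_orthogonalProjectionOnto_le_of_le {W₁ W₂ : Submodule 𝕜 E} [FiniteDimensional 𝕜 W₁]
    [FiniteDimensional 𝕜 W₂] (hW : W₁ ≤ W₂) (x : E) :
    ‖W₁.orthogonalProjectionOnto x‖ ≤ ‖W₂.orthogonalProjectionOnto x‖ := by
  rw [← Submodule.orthogonalProjectionOnto_starProjection_of_le hW x]
  exact W₁.norm_orthogonalProjectionOnto_apply_le _

/-- Interlacing of principal angles: shrinking the first subspace and enlarging the second one
decreases the principal angles, counted from the largest one. -/
theorem IsPrincipalAngles.le_of_le {V₁ W₁ V₂ W₂ : Submodule 𝕜 E} [FiniteDimensional 𝕜 V₂]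
    [FiniteDimensional 𝕜 W₁] [FiniteDimensional 𝕜 W₂] {m n : ℕ} {θ₁ : Fin m → ℝ} {θ₂ : Fin n → ℝ}
    (h₁ : IsPrincipalAngles V₁ W₁ θ₁) (h₂ : IsPrincipalAngles V₂ W₂ θ₂)
    (hm : Module.finrank 𝕜 V₁ = m) (hn : Module.finrank 𝕜 V₂ = n) (hV : V₂ ≤ V₁) (hW : W₁ ≤ W₂)
    {i : Fin n} {j : Fin m} (hij : (j : ℕ) + n = i + m) : θ₂ i ≤ θ₁ j := by
  have hθ₁ := h₁.2.1
  have hθ₂ := h₂.2.1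
  obtain ⟨e₁, he₁⟩ := norm_sq_orthogonalProjectionOnto_eq_sum h₁ hm
  obtain ⟨e₂, he₂⟩ := norm_sq_orthogonalProjectionOnto_eq_sum h₂ hn
  -- Courant–Fischer count: there are `i + (m - 1 - j) = n - 1` conditions on the `n`-dimensional
  -- `V₂`, so some nonzero `x` has no `e₂`-coordinate before `i` and no `e₁`-coordinate after `j`.
  let L : V₂ →ₗ[𝕜] ({k : Fin n // k < i} ⊕ {k : Fin m // j < k} → 𝕜) :=
    LinearMap.pi (Sum.elim (fun k => (innerSL 𝕜 (e₂ k)).toLinearMap)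
      (fun k => (innerSL 𝕜 (e₁ k)).toLinearMap ∘ₗ Submodule.inclusion hV))
  have hL : LinearMap.ker L ≠ ⊥ := by
    apply LinearMap.ker_ne_bot_of_finrank_lt
    rw [Module.finrank_fintype_fun_eq_card, hn, Fintype.card_sum, Fintype.card_subtype,
      Fintype.card_subtype, Finset.filter_gt_eq_Iio, Finset.filter_lt_eq_Ioi, Fin.card_Iio,
      Fin.card_Ioi]
    omega
  obtain ⟨x, hx, hx0⟩ := Submodule.exists_mem_ne_zero_of_ne_bot hL
  rw [LinearMap.mem_ker] at hx
  have hx₂ : ∀ k, k < i → inner 𝕜 (e₂ k) x = 0 := fun k hk => congrFun hx (Sum.inl ⟨k, hk⟩)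
  have hx₁ : ∀ k, j < k → inner 𝕜 (e₁ k) (Submodule.inclusion hV x) = 0 :=
    fun k hk => congrFun hx (Sum.inr ⟨k, hk⟩)
  have hpos : 0 < ‖x‖ ^ 2 := by positivity
  have hup : ‖W₂.orthogonalProjectionOnto (x : E)‖ ^ 2 ≤ Real.cos (θ₂ i) ^ 2 * ‖x‖ ^ 2 := by
    rw [he₂ x, ← e₂.sum_sq_norm_inner_right x, Finset.mul_sum]
    refine Finset.sum_le_sum fun k _ => ?_
    rcases lt_or_ge k i with hk | hk
    · simp [hx₂ k hk]
    · exact mul_le_mul_of_nonneg_right (cos_sq_anti_of_mem_angleTuples hθ₂ hk) (by positivity)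
  have hlow : Real.cos (θ₁ j) ^ 2 * ‖x‖ ^ 2 ≤ ‖W₁.orthogonalProjectionOnto (x : E)‖ ^ 2 := by
    have hnorm : ‖x‖ = ‖Submodule.inclusion hV x‖ := rfl
    have := he₁ (Submodule.inclusion hV x)
    rw [Submodule.coe_inclusion] at this
    rw [this, hnorm, ← e₁.sum_sq_norm_inner_right (Submodule.inclusion hV x), Finset.mul_sum]
    refine Finset.sum_le_sum fun k _ => ?_
    rcases lt_or_ge j k with hk | hk
    · simp [hx₁ k hk]
    · exact mul_le_mul_of_nonneg_right (cos_sq_anti_of_mem_angleTuples hθ₁ hk) (by positivity)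
  have hmid := pow_le_pow_left₀ (norm_nonneg _)
    (norm_orthogonalProjectionOnto_le_of_le hW (x : E)) 2
  have hcos2 : Real.cos (θ₁ j) ^ 2 ≤ Real.cos (θ₂ i) ^ 2 :=
    le_of_mul_le_mul_right (hlow.trans (hmid.trans hup)) hpos
  have hpi := Real.pi_pos
  have hi := hθ₂.2 i
  have hj := hθ₁.2 j
  have hcos : Real.cos (θ₁ j) ≤ Real.cos (θ₂ i) :=
    le_of_sq_le_sq hcos2 (Real.cos_nonneg_of_mem_Icc ⟨by linarith [hi.1], hi.2⟩)
  exact (Real.strictAntiOn_cos.le_iff_ge ⟨hj.1, by linarith [hj.2]⟩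
    ⟨hi.1, by linarith [hi.2]⟩).1 hcos

theorem IsPrincipalAngles.unique {V W : Submodule 𝕜 E} [FiniteDimensional 𝕜 V]
    [FiniteDimensional 𝕜 W] {m : ℕ} {θ θ' : Fin m → ℝ} (h : IsPrincipalAngles V W θ)
    (h' : IsPrincipalAngles V W θ') (hm : Module.finrank 𝕜 V = m) : θ = θ' :=
  funext fun _ => le_antisymm (h'.le_of_le h hm hm le_rfl le_rfl rfl)
    (h.le_of_le h' hm hm le_rfl le_rfl rfl)

/-- Singular value decomposition of the projection `A : V → W`: an eigenbasis of `A* A` has pairwise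
orthogonal images, whose norms are the cosines. -/
theorem exists_isPrincipalAngles {V W : Submodule 𝕜 E} [FiniteDimensional 𝕜 V]
    [FiniteDimensional 𝕜 W] {m : ℕ} (hm : Module.finrank 𝕜 V = m)
    (hle : m ≤ Module.finrank 𝕜 W) :
    ∃ θ : Fin m → ℝ, IsPrincipalAngles V W θ := by
  subst hm
  let A : V →ₗ[𝕜] W := W.orthogonalProjectionOnto.toLinearMap ∘ₗ V.subtype
  have hA : ∀ (x : V) (y : W), inner 𝕜 (A x) y = inner 𝕜 (x : E) (y : E) := fun x y =>
    Submodule.inner_orthogonalProjectionOnto_eq_of_mem_right y (x : E)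
  have hT : (A.adjoint ∘ₗ A).IsSymmetric := A.isSymmetric_adjoint_comp_self
  set e := hT.eigenvectorBasis rfl with he
  set l := hT.eigenvalues rfl with hl
  have hAe : ∀ i j, inner 𝕜 (A (e i)) (A (e j)) = if i = j then (l i : 𝕜) else 0 := by
    intro i j
    rw [← LinearMap.adjoint_inner_left, ← LinearMap.comp_apply, hT.apply_eigenvectorBasis,
      inner_smul_left, ← he, e.inner_eq_ite, ← hl]
    split_ifs <;> simp
  have hnorm : ∀ i, ‖A (e i)‖ ^ 2 = l i := by
    intro i
    rw [@norm_sq_eq_re_inner 𝕜, hAe, if_pos rfl, RCLike.ofReal_re]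
  have hsqrt : ∀ i, Real.sqrt (l i) = ‖A (e i)‖ := fun i => by
    rw [← hnorm, Real.sqrt_sq (norm_nonneg _)]
  have hle1 : ∀ i, ‖A (e i)‖ ≤ 1 := fun i => by
    refine (W.norm_orthogonalProjectionOnto_apply_le (e i : E)).trans ?_
    exact (e.orthonormal.1 i).le
  have hcos : ∀ i, Real.cos (Real.arccos ‖A (e i)‖) = ‖A (e i)‖ := fun i =>
    Real.cos_arccos (by linarith [norm_nonneg (A (e i))]) (hle1 i)
  -- Normalized images of `e`; outside `s` the value is irrelevant, since only the family on `s` is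
  -- extended to an orthonormal basis.
  let v : Fin (Module.finrank 𝕜 W) → W := fun j =>
    if hj : (j : ℕ) < Module.finrank 𝕜 V then ((‖A (e ⟨j, hj⟩)‖⁻¹ : ℝ) : 𝕜) • A (e ⟨j, hj⟩) else 0
  let s : Set (Fin (Module.finrank 𝕜 W)) :=
    {j | ∃ hj : (j : ℕ) < Module.finrank 𝕜 V, A (e ⟨j, hj⟩) ≠ 0}
  have hv : Orthonormal 𝕜 (s.domRestrict v) := by
    constructor
    · rintro ⟨j, hj, hj0⟩
      simp only [Set.domRestrict_apply, v, dif_pos hj]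
      rw [norm_smul, RCLike.norm_ofReal, abs_of_nonneg (by positivity),
        inv_mul_cancel₀ (norm_ne_zero_iff.2 hj0)]
    · rintro ⟨j, hj, hj0⟩ ⟨k, hk, hk0⟩ hjk
      simp only [Set.domRestrict_apply, v, dif_pos hj, dif_pos hk]
      rw [inner_smul_left, inner_smul_right, hAe, if_neg]
      · simp
      · intro h
        exact hjk (Subtype.ext (Fin.ext (by simpa using h)))
  obtain ⟨f, hf⟩ := hv.exists_orthonormalBasis_extension_of_card_eq (by simp)
  have hAf : ∀ i, A (e i) = ((‖A (e i)‖ : ℝ) : 𝕜) • f (Fin.castLE hle i) := by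
    intro i
    by_cases h0 : A (e i) = 0
    · simp [h0]
    · rw [hf (Fin.castLE hle i) ⟨i.2, h0⟩]
      simp only [v, Fin.val_castLE, Fin.is_lt, dif_pos, Fin.eta, smul_smul]
      rw [← RCLike.ofReal_mul, mul_inv_cancel₀ (norm_ne_zero_iff.2 h0), RCLike.ofReal_one,
        one_smul]
  refine ⟨fun i => Real.arccos ‖A (e i)‖, (min_eq_left hle).symm, ⟨?_, ?_⟩, e, f, ?_, ?_⟩
  · intro i j hij
    refine Real.arccos_le_arccos ?_
    rw [← hsqrt, ← hsqrt]
    exact Real.sqrt_le_sqrt (hT.eigenvalues_antitone rfl hij)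
  · exact fun i => ⟨Real.arccos_nonneg _, Real.arccos_le_pi_div_two.2 (norm_nonneg _)⟩
  · intro i j hij
    rw [← hA, hAf, inner_smul_left, f.inner_eq_zero, mul_zero]
    exact fun h => hij (by rw [← h]; rfl)
  · intro k i j hi hj
    obtain rfl : i = k := Fin.ext hi
    obtain rfl : j = Fin.castLE hle i := Fin.ext hj
    rw [← hA, hAf, inner_smul_left, f.inner_eq_one, mul_one, RCLike.conj_ofReal, hcos]

/-- The larger of the two subspaces contains a subspace of the dimension of the smaller one with
the same principal angles. -/
theorem IsPrincipalAngles.exists_le {V W : Submodule 𝕜 E} {m : ℕ} {θ : Fin m → ℝ}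
    (h : IsPrincipalAngles V W θ) (hm : Module.finrank 𝕜 V = m) :
    ∃ W' ≤ W, Module.finrank 𝕜 W' = m ∧ IsPrincipalAngles V W' θ := by
  subst hm
  obtain ⟨hmin, hθ, e, f, hne, heq⟩ := h
  have hle : Module.finrank 𝕜 V ≤ Module.finrank 𝕜 W := by omega
  have hf := (orthonormal_coe_orthonormalBasis f).comp _ (Fin.castLE_injective hle)
  refine ⟨Submodule.span 𝕜 (Set.range ((fun j => (f j : E)) ∘ Fin.castLE hle)), ?_, ?_, ?_⟩
  · rw [Submodule.span_le]
    rintro _ ⟨i, rfl⟩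
    exact (f (Fin.castLE hle i)).2
  · simpa using finrank_span_eq_card hf.linearIndependent
  · have := isPrincipalAngles_span (min_self _).symm (orthonormal_coe_orthonormalBasis e) hf hθ
      (fun i j hij => hne _ _ hij) (fun k i j hi hj => heq _ _ _ hi hj)
    rwa [span_range_coe_orthonormalBasis e] at this

end PrincipalAngles

/-! ### Infima in `[0, D]` -/

section InfIn

variable {D x : ℝ≥0∞} {S : Set ℝ≥0∞}

theorem infIn_le_bound : infIn D S ≤ D :=
  (sInf {x : Set.Iic D | (x : ℝ≥0∞) ∈ S} : Set.Iic D).2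

theorem infIn_le (hx : x ∈ S) (hxD : x ≤ D) : infIn D S ≤ x :=
  Subtype.coe_le_coe.2
    (sInf_le (a := (⟨x, hxD⟩ : Set.Iic D)) (s := {x : Set.Iic D | (x : ℝ≥0∞) ∈ S}) hx)

theorem le_infIn (hxD : x ≤ D) (h : ∀ y ∈ S, x ≤ y) : x ≤ infIn D S :=
  Subtype.coe_le_coe.2
    (le_sInf (a := (⟨x, hxD⟩ : Set.Iic D)) (s := {x : Set.Iic D | (x : ℝ≥0∞) ∈ S})
      fun b hb => h b hb)

end InfIn

/-! ### Diameters and zero-padded angle tuples -/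

theorem le_diam {M : Type*} (d : M → M → ℝ≥0∞) (x y : M) : d x y ≤ diam d :=
  le_iSup₂ (f := fun x y => d x y) x y

theorem append_zero_mem_angleTuples {k p : ℕ} {θ : Fin p → ℝ} (hθ : θ ∈ angleTuples p) :
    Fin.append (fun _ : Fin k => (0 : ℝ)) θ ∈ angleTuples (k + p) := by
  constructor
  · intro i j hij
    induction i using Fin.addCases with
    | left i =>
      induction j using Fin.addCases with
      | left j => simp
      | right j => simpa using (hθ.2 j).1
    | right i =>
      induction j using Fin.addCases with
      | left j =>
        have := Fin.le_def.1 hij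
        simp only [Fin.val_natAdd, Fin.val_castAdd] at this
        omega
      | right j => simpa using hθ.1 (by simpa using hij)
  · intro i
    induction i using Fin.addCases with
    | left i => simpa using Real.pi_div_two_pos.le
    | right i => simpa using hθ.2 i

theorem le_of_interlacing {f : ∀ p : ℕ, (Fin p → ℝ) → ℝ≥0∞}
    (hmono : ∀ p, 0 < p → MonotoneOn (f p) (angleTuples p))
    (hpad : ∀ k p, 0 < k → 0 < p → ∀ θ ∈ angleTuples p,
      f (k + p) (Fin.append (fun _ : Fin k => (0 : ℝ)) θ) = f p θ)
    {r p : ℕ} (hr : 0 < r) (hrp : r ≤ p) {θ' : Fin r → ℝ} {θ : Fin p → ℝ}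
    (hθ' : θ' ∈ angleTuples r) (hθ : θ ∈ angleTuples p)
    (h : ∀ (i : Fin r) (j : Fin p), (j : ℕ) + r = i + p → θ' i ≤ θ j) : f r θ' ≤ f p θ := by
  obtain ⟨k, rfl⟩ := Nat.exists_eq_add_of_le' hrp
  rcases Nat.eq_zero_or_pos k with rfl | hk
  -- Here the larger index is `0 + r`, not syntactically `r`; generalizing it to `n` allows
  -- substitution.
  · have key : ∀ (n : ℕ) (hn : r = n) (θ : Fin n → ℝ), θ ∈ angleTuples n →
        (∀ (i : Fin r) (j : Fin n), (j : ℕ) = i → θ' i ≤ θ j) → f r θ' ≤ f n θ := by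
      rintro _ rfl θ hθ h
      exact hmono r hr hθ' hθ fun i => h i i rfl
    exact key _ (zero_add r).symm θ hθ fun i j hij => h i j (by omega)
  · rw [← hpad k r hk hr θ' hθ']
    refine hmono _ (by omega) (append_zero_mem_angleTuples hθ') hθ fun j => ?_
    induction j using Fin.addCases with
    | left j => simpa using (hθ.2 _).1
    | right j => simpa using h j _ (by simp; omega)

/-! ### The infinite Grassmannian: there is always room for new orthogonal directions -/

section FullGr

variable {𝕜 : Type*} [RCLike 𝕜]

theorem coordSpace_mono {m n : ℕ} (h : m ≤ n) : coordSpace 𝕜 m ≤ coordSpace 𝕜 n :=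
  fun _ hx k hk => hx k (h.trans hk)

instance finiteDimensional_coordSpace (n : ℕ) : FiniteDimensional 𝕜 (coordSpace 𝕜 n) := by
  let L : coordSpace 𝕜 n →ₗ[𝕜] (Fin n → 𝕜) :=
    { toFun := fun x i => (x : Ambient 𝕜) i
      map_add' := fun x y => by ext i; simp
      map_smul' := fun c x => by ext i; simp }
  refine FiniteDimensional.of_injective L fun x y hxy => ?_
  ext k
  rcases lt_or_ge k n with hk | hk
  · exact congrFun hxy ⟨k, hk⟩
  · rw [x.2 k hk, y.2 k hk]

instance FullGr.finiteDimensional (V : FullGr 𝕜) : FiniteDimensional 𝕜 V.1 := by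
  obtain ⟨n, hn⟩ := V.2
  exact Submodule.finiteDimensional_of_le hn

/-- A subspace of an element of the full Grassmannian, as an element of some Grassmannian. -/
def Gr.ofLe (W : FullGr 𝕜) {V : Submodule 𝕜 (Ambient 𝕜)} (h : V ≤ W.1) {p : ℕ}
    (hp : Module.finrank 𝕜 V = p) : Gr 𝕜 p :=
  ⟨⟨V, W.2.imp fun _ hn => h.trans hn⟩, hp⟩

instance subsingleton_gr_zero : Subsingleton (Gr 𝕜 0) := by
  refine ⟨fun V W => Subtype.ext (Subtype.ext ?_)⟩
  rw [Submodule.finrank_eq_zero.1 V.2, Submodule.finrank_eq_zero.1 W.2]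

/-- The consecutive standard unit vectors starting at position `n`. -/
def unitVectors (𝕜 : Type*) [RCLike 𝕜] (n k : ℕ) (i : Fin k) : Ambient 𝕜 :=
  lp.single 2 (n + i) (1 : 𝕜)

theorem orthonormal_unitVectors (n k : ℕ) : Orthonormal 𝕜 (unitVectors 𝕜 n k) := by
  rw [orthonormal_iff_ite]
  intro i j
  rw [unitVectors, unitVectors, lp.inner_single_left, lp.single_apply, Pi.single_apply]
  by_cases h : i = j
  · simp [h]
  · have h' : (i : ℕ) ≠ j := fun h' => h (Fin.ext h')
    simp [h, h']

theorem unitVectors_mem_coordSpace (n k : ℕ) (i : Fin k) :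
    unitVectors 𝕜 n k i ∈ coordSpace 𝕜 (n + k) := by
  intro l hl
  rw [unitVectors, lp.single_apply_ne]
  omega

theorem unitVectors_notMem_coordSpace (n k : ℕ) (i : Fin k) :
    unitVectors 𝕜 n k i ∉ coordSpace 𝕜 n := by
  intro h
  have := h (n + i) (by omega)
  rw [unitVectors, lp.single_apply_self] at this
  exact one_ne_zero this

theorem inner_unitVectors_of_mem_coordSpace {n k : ℕ} (i : Fin k) {x : Ambient 𝕜}
    (hx : x ∈ coordSpace 𝕜 n) : inner 𝕜 (unitVectors 𝕜 n k i) x = 0 := by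
  rw [unitVectors, lp.inner_single_left, hx _ (by omega), inner_zero_right]

theorem exists_gr_ne {p : ℕ} (hp : 0 < p) (W : FullGr 𝕜) : ∃ V : Gr 𝕜 p, V.1 ≠ W := by
  obtain ⟨n, hn⟩ := W.2
  refine ⟨⟨⟨Submodule.span 𝕜 (Set.range (unitVectors 𝕜 n p)), n + p, ?_⟩, ?_⟩, ?_⟩
  · rw [Submodule.span_le]
    rintro _ ⟨i, rfl⟩
    exact unitVectors_mem_coordSpace n p i
  · exact (finrank_span_eq_card (orthonormal_unitVectors (𝕜 := 𝕜) n p).linearIndependent).trans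
      (Fintype.card_fin p)
  · rintro rfl
    exact unitVectors_notMem_coordSpace n p ⟨0, hp⟩ (hn (Submodule.subset_span ⟨_, rfl⟩))

theorem orthonormal_append_unitVectors {n k p : ℕ} {e : Fin p → Ambient 𝕜} (he : Orthonormal 𝕜 e)
    (hn : ∀ i, e i ∈ coordSpace 𝕜 n) : Orthonormal 𝕜 (Fin.append (unitVectors 𝕜 n k) e) := by
  constructor
  · intro i
    induction i using Fin.addCases with
    | left i => simpa using (orthonormal_unitVectors (𝕜 := 𝕜) n k).1 i
    | right i => simpa using he.1 i
  · intro i j hij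
    induction i using Fin.addCases with
    | left i =>
      induction j using Fin.addCases with
      | left j =>
        simpa using (orthonormal_unitVectors (𝕜 := 𝕜) n k).2 fun h => hij (by rw [h])
      | right j => simpa using inner_unitVectors_of_mem_coordSpace i (hn j)
    | right i =>
      induction j using Fin.addCases with
      | left j =>
        simpa using inner_eq_zero_symm.1 (inner_unitVectors_of_mem_coordSpace j (hn i))
      | right j => simpa using he.2 fun h => hij (by rw [h])

/-- Adding a common orthogonal subspace prepends zeros to the principal angles. -/
theorem exists_isPrincipalAngles_append {p : ℕ} (k : ℕ) (V W : Gr 𝕜 p) {θ : Fin p → ℝ}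
    (h : IsPrincipalAngles V.1.1 W.1.1 θ) :
    ∃ V' W' : Gr 𝕜 (k + p),
      IsPrincipalAngles V'.1.1 W'.1.1 (Fin.append (fun _ : Fin k => (0 : ℝ)) θ) := by
  obtain ⟨⟨V, nV, hV⟩, hVp⟩ := V
  obtain ⟨⟨W, nW, hW⟩, hWp⟩ := W
  change Module.finrank 𝕜 V = p at hVp
  change Module.finrank 𝕜 W = p at hWp
  obtain ⟨-, hθ, e, f, hne, heq⟩ := h
  change OrthonormalBasis (Fin (Module.finrank 𝕜 V)) 𝕜 V at e
  change OrthonormalBasis (Fin (Module.finrank 𝕜 W)) 𝕜 W at f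
  -- Both subspaces lie in the first `n` coordinates, so unit vectors from position `n` on are
  -- orthogonal to both.
  set n := max nV nW
  let e' : Fin p → Ambient 𝕜 := fun i => e (Fin.cast hVp.symm i)
  let f' : Fin p → Ambient 𝕜 := fun i => f (Fin.cast hWp.symm i)
  have he' : Orthonormal 𝕜 e' :=
    (orthonormal_coe_orthonormalBasis e).comp _ (Fin.cast_injective _)
  have hf' : Orthonormal 𝕜 f' :=
    (orthonormal_coe_orthonormalBasis f).comp _ (Fin.cast_injective _)
  have hen : ∀ i, e' i ∈ coordSpace 𝕜 n := fun i =>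
    coordSpace_mono (le_max_left nV nW) (hV (e _).2)
  have hfn : ∀ i, f' i ∈ coordSpace 𝕜 n := fun i =>
    coordSpace_mono (le_max_right nV nW) (hW (f _).2)
  have mem : ∀ g : Fin p → Ambient 𝕜, (∀ i, g i ∈ coordSpace 𝕜 n) →
      Submodule.span 𝕜 (Set.range (Fin.append (unitVectors 𝕜 n k) g)) ≤ coordSpace 𝕜 (n + k) := by
    intro g hg
    rw [Submodule.span_le]
    rintro _ ⟨i, rfl⟩
    induction i using Fin.addCases with
    | left i => simpa using unitVectors_mem_coordSpace n k i
    | right i => simpa using coordSpace_mono (Nat.le_add_right n k) (hg i)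
  have hE := orthonormal_append_unitVectors (k := k) he' hen
  have hF := orthonormal_append_unitVectors (k := k) hf' hfn
  refine ⟨⟨⟨_, _, mem e' hen⟩, ?_⟩, ⟨⟨_, _, mem f' hfn⟩, ?_⟩, ?_⟩
  · exact (finrank_span_eq_card hE.linearIndependent).trans (Fintype.card_fin _)
  · exact (finrank_span_eq_card hF.linearIndependent).trans (Fintype.card_fin _)
  have hZ := orthonormal_iff_ite.1 (orthonormal_unitVectors (𝕜 := 𝕜) n k)
  refine isPrincipalAngles_span (min_self _).symm hE hF (append_zero_mem_angleTuples hθ) ?_ ?_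
  · intro i j hij
    induction i using Fin.addCases with
    | left i =>
      induction j using Fin.addCases with
      | left j =>
        rw [Fin.append_left, Fin.append_left, hZ, if_neg]
        rintro rfl
        exact hij rfl
      | right j => simpa using inner_unitVectors_of_mem_coordSpace i (hfn j)
    | right i =>
      induction j using Fin.addCases with
      | left j =>
        simpa using inner_eq_zero_symm.1 (inner_unitVectors_of_mem_coordSpace j (hen i))
      | right j =>
        rw [Fin.append_right, Fin.append_right]
        exact hne _ _ fun h => hij (by simpa using h)
  · intro l i j hi hj
    obtain rfl : i = l := Fin.ext hi
    obtain rfl : j = i := Fin.ext hj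
    induction j using Fin.addCases with
    | left j => rw [Fin.append_left, Fin.append_left, hZ]; simp
    | right j =>
      rw [Fin.append_right, Fin.append_right, Fin.append_right]
      exact heq _ _ _ rfl rfl

end FullGr

/-! ### The asymmetric extension -/

section AsymExtension

variable {𝕜 : Type*} [RCLike 𝕜] {d : ∀ p : ℕ, Gr 𝕜 p → Gr 𝕜 p → ℝ≥0∞}
  {f : ∀ p : ℕ, (Fin p → ℝ) → ℝ≥0∞}

theorem asymExtension_le_diam (V W : FullGr 𝕜) : asymExtension d V W ≤ diam (d V.dim) :=
  infIn_le_bound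

theorem asymExtension_le {V W : FullGr 𝕜} (W' : Gr 𝕜 V.dim) (h : W'.1.1 ≤ W.1) :
    asymExtension d V W ≤ d V.dim ⟨V, rfl⟩ W' :=
  infIn_le ⟨W', h, rfl⟩ (le_diam _ _ _)

theorem asymExtension_eq_diam_of_lt {V W : FullGr 𝕜} (h : W.dim < V.dim) :
    asymExtension d V W = diam (d V.dim) := by
  refine le_antisymm (asymExtension_le_diam V W) (le_infIn le_rfl ?_)
  rintro _ ⟨W', hW', -⟩
  have : W'.1.dim ≤ W.dim := Submodule.finrank_mono hW'
  rw [W'.2] at this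
  omega

theorem diam_zero (hd : ∀ p, IsMetric (d p)) : diam (d 0) = 0 := by
  simp only [diam, ENNReal.iSup_eq_zero]
  exact fun V W => ((hd 0).eq_zero_iff V W).2 (Subsingleton.elim V W)

theorem diam_pos (hd : ∀ p, IsMetric (d p)) {p : ℕ} (hp : 0 < p) (V : Gr 𝕜 p) :
    0 < diam (d p) := by
  obtain ⟨W, hW⟩ := exists_gr_ne hp V.1
  refine lt_of_lt_of_le (pos_iff_ne_zero.2 fun h => hW ?_) (le_diam (d p) W V)
  rw [((hd p).eq_zero_iff W V).1 h]

/-- Adding a common orthogonal summand to both subspaces prepends zero angles, hence preserves the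
distance. -/
theorem diam_le_diam (hdf : ∀ p, 0 < p → ∀ (V W : Gr 𝕜 p) (θ : Fin p → ℝ),
      IsPrincipalAngles V.1.1 W.1.1 θ → d p V W = f p θ)
    (hpad : ∀ k p, 0 < k → 0 < p → ∀ θ ∈ angleTuples p,
      f (k + p) (Fin.append (fun _ : Fin k => (0 : ℝ)) θ) = f p θ)
    {r p : ℕ} (hr : 0 < r) (hrp : r ≤ p) : diam (d r) ≤ diam (d p) := by
  rcases hrp.eq_or_lt with rfl | hlt
  · exact le_rfl
  obtain ⟨k, rfl⟩ := Nat.exists_eq_add_of_le' hrp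
  refine iSup₂_le fun V W => ?_
  obtain ⟨θ, hθ⟩ := exists_isPrincipalAngles (V := V.1.1) (W := W.1.1) V.2 W.2.ge
  obtain ⟨V', W', h'⟩ := exists_isPrincipalAngles_append k V W hθ
  rw [hdf r hr V W θ hθ, ← hpad k r (by omega) hr θ hθ.2.1, ← hdf _ (by omega) V' W' _ h']
  exact le_diam _ _ _

theorem exists_gr_le_eq (hdf : ∀ p, 0 < p → ∀ (V W : Gr 𝕜 p) (θ : Fin p → ℝ),
      IsPrincipalAngles V.1.1 W.1.1 θ → d p V W = f p θ)
    {p : ℕ} (hp : 0 < p) (V : Gr 𝕜 p) {W : FullGr 𝕜} {θ : Fin p → ℝ}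
    (h : IsPrincipalAngles V.1.1 W.1 θ) :
    ∃ W' : Gr 𝕜 p, W'.1.1 ≤ W.1 ∧ d p V W' = f p θ := by
  obtain ⟨W', hle, hW', h'⟩ := h.exists_le V.2
  exact ⟨Gr.ofLe W hle hW', hle, hdf p hp V _ θ h'⟩

theorem asymExtension_eq (hmono : ∀ p, 0 < p → MonotoneOn (f p) (angleTuples p))
    (hdf : ∀ p, 0 < p → ∀ (V W : Gr 𝕜 p) (θ : Fin p → ℝ),
      IsPrincipalAngles V.1.1 W.1.1 θ → d p V W = f p θ)
    {V W : FullGr 𝕜} (hV : 0 < V.dim) {θ : Fin V.dim → ℝ} (h : IsPrincipalAngles V.1 W.1 θ) :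
    asymExtension d V W = f V.dim θ := by
  obtain ⟨W₀, hW₀, hd₀⟩ := exists_gr_le_eq hdf hV ⟨V, rfl⟩ h
  refine le_antisymm (hd₀ ▸ asymExtension_le W₀ hW₀) (le_infIn (hd₀ ▸ le_diam _ _ _) ?_)
  rintro _ ⟨W', hW', rfl⟩
  obtain ⟨θ', h'⟩ := exists_isPrincipalAngles (V := V.1) (W := W'.1.1) rfl W'.2.ge
  rw [hdf _ hV ⟨V, rfl⟩ W' θ' h']
  -- Interlacing with `V` fixed and `W' ≤ W`: every angle with `W` is at most the one with `W'`.
  exact hmono _ hV h.2.1 h'.2.1 fun i => h'.le_of_le h rfl rfl le_rfl hW' rfl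

theorem exists_asymExtension_eq (hmono : ∀ p, 0 < p → MonotoneOn (f p) (angleTuples p))
    (hdf : ∀ p, 0 < p → ∀ (V W : Gr 𝕜 p) (θ : Fin p → ℝ),
      IsPrincipalAngles V.1.1 W.1.1 θ → d p V W = f p θ)
    {V W : FullGr 𝕜} (hV : 0 < V.dim) (hVW : V.dim ≤ W.dim) :
    ∃ W' : Gr 𝕜 V.dim, W'.1.1 ≤ W.1 ∧ asymExtension d V W = d V.dim ⟨V, rfl⟩ W' := by
  obtain ⟨θ, h⟩ := exists_isPrincipalAngles (V := V.1) (W := W.1) rfl hVW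
  obtain ⟨W', hW', hd'⟩ := exists_gr_le_eq hdf hV ⟨V, rfl⟩ h
  exact ⟨W', hW', (asymExtension_eq hmono hdf hV h).trans hd'.symm⟩

theorem asymExtension_eq_zero_of_dim_eq_zero (hd : ∀ p, IsMetric (d p)) {V : FullGr 𝕜}
    (hV : V.dim = 0) (W : FullGr 𝕜) : asymExtension d V W = 0 := by
  have h := asymExtension_le_diam (d := d) V W
  rw [hV, diam_zero hd] at h
  exact nonpos_iff_eq_zero.1 h

theorem asymExtension_triangle (hd : ∀ p, IsMetric (d p))
    (hmono : ∀ p, 0 < p → MonotoneOn (f p) (angleTuples p))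
    (hdf : ∀ p, 0 < p → ∀ (V W : Gr 𝕜 p) (θ : Fin p → ℝ),
      IsPrincipalAngles V.1.1 W.1.1 θ → d p V W = f p θ)
    (hpad : ∀ k p, 0 < k → 0 < p → ∀ θ ∈ angleTuples p,
      f (k + p) (Fin.append (fun _ : Fin k => (0 : ℝ)) θ) = f p θ)
    (U V W : FullGr 𝕜) :
    asymExtension d U W ≤ asymExtension d U V + asymExtension d V W := by
  rcases Nat.eq_zero_or_pos U.dim with hU | hU
  · rw [asymExtension_eq_zero_of_dim_eq_zero hd hU]
    exact zero_le
  rcases lt_or_ge V.dim U.dim with hUV | hUV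
  · rw [asymExtension_eq_diam_of_lt hUV]
    exact (asymExtension_le_diam U W).trans le_self_add
  have hV : 0 < V.dim := hU.trans_le hUV
  rcases lt_or_ge W.dim V.dim with hVW | hVW
  · rw [asymExtension_eq_diam_of_lt hVW]
    exact ((asymExtension_le_diam U W).trans (diam_le_diam hdf hpad hU hUV)).trans le_add_self
  obtain ⟨V', hV'V, hUV'⟩ := exists_asymExtension_eq hmono hdf hU hUV
  obtain ⟨θ, hθ⟩ := exists_isPrincipalAngles (V := V.1) (W := W.1) rfl hVW
  obtain ⟨θ', hθ'⟩ := exists_isPrincipalAngles (V := V'.1.1) (W := W.1) V'.2 (hUV.trans hVW)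
  -- `W'` is chosen optimal for `V'` rather than for `U`, so that the last term depends only on the
  -- angles of `V'` and `W`.
  obtain ⟨W', hW'W, hV'W'⟩ := exists_gr_le_eq hdf hU V' hθ'
  rw [hUV', asymExtension_eq hmono hdf hV hθ]
  calc asymExtension d U W ≤ d U.dim ⟨U, rfl⟩ W' := asymExtension_le W' hW'W
    _ ≤ d U.dim ⟨U, rfl⟩ V' + d U.dim V' W' := (hd _).triangle _ _ _
    _ ≤ d U.dim ⟨U, rfl⟩ V' + f V.dim θ := by
      rw [hV'W']
      exact add_le_add_right (le_of_interlacing hmono hpad hU hUV hθ'.2.1 hθ.2.1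
        fun i j hij => hθ.le_of_le hθ' rfl V'.2 hV'V le_rfl hij) _

theorem asymExtension_self (hd : ∀ p, IsMetric (d p)) (V : FullGr 𝕜) : asymExtension d V V = 0 :=
  nonpos_iff_eq_zero.1 ((asymExtension_le ⟨V, rfl⟩ le_rfl).trans_eq
    (((hd _).eq_zero_iff _ _).2 rfl))

theorem dim_le_of_asymExtension_eq_zero (hd : ∀ p, IsMetric (d p)) {V W : FullGr 𝕜}
    (h : asymExtension d V W = 0) : V.dim ≤ W.dim := by
  by_contra! hlt
  rw [asymExtension_eq_diam_of_lt hlt] at h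
  exact (diam_pos hd (Nat.zero_lt_of_lt hlt) ⟨V, rfl⟩).ne' h

theorem asymExtension_separation (hd : ∀ p, IsMetric (d p))
    (hmono : ∀ p, 0 < p → MonotoneOn (f p) (angleTuples p))
    (hdf : ∀ p, 0 < p → ∀ (V W : Gr 𝕜 p) (θ : Fin p → ℝ),
      IsPrincipalAngles V.1.1 W.1.1 θ → d p V W = f p θ)
    (V W : FullGr 𝕜) : (asymExtension d V W = 0 ∧ asymExtension d W V = 0) ↔ V = W := by
  constructor
  · rintro ⟨h₁, h₂⟩
    have hdim : V.dim = W.dim := le_antisymm (dim_le_of_asymExtension_eq_zero hd h₁)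
      (dim_le_of_asymExtension_eq_zero hd h₂)
    refine Subtype.ext (Submodule.eq_of_le_of_finrank_eq ?_ hdim)
    rcases Nat.eq_zero_or_pos V.dim with hV | hV
    · rw [Submodule.finrank_eq_zero.1 hV]
      exact bot_le
    -- Attainment is essential: a zero infimum gives an actual `W' ≤ W` at distance zero from `V`,
    -- so `V = W'`.
    · obtain ⟨W', hW', h⟩ := exists_asymExtension_eq hmono hdf hV hdim.le
      have hVW' := ((hd _).eq_zero_iff _ _).1 (h.symm.trans h₁)
      rwa [← hVW'] at hW'
  · rintro rfl
    exact ⟨asymExtension_self hd V, asymExtension_self hd V⟩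

end AsymExtension

end InfGrassmannian

theorem mainTheorem2 (𝕜 : Type*) [RCLike 𝕜]
    (d : ∀ p : ℕ, InfGrassmannian.Gr 𝕜 p → InfGrassmannian.Gr 𝕜 p → ℝ≥0∞)
    (f : ∀ p : ℕ, (Fin p → ℝ) → ℝ≥0∞)
    (hd : ∀ p, InfGrassmannian.IsMetric (d p))
    (hmono : ∀ p, 0 < p → MonotoneOn (f p) (InfGrassmannian.angleTuples p))
    (hdf : ∀ p, 0 < p → ∀ (V W : InfGrassmannian.Gr 𝕜 p) (θ : Fin p → ℝ),
      InfGrassmannian.IsPrincipalAngles V.1.1 W.1.1 θ → d p V W = f p θ)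
    (hpad : ∀ k p, 0 < k → 0 < p → ∀ θ ∈ InfGrassmannian.angleTuples p,
      f (k + p) (Fin.append (fun _ : Fin k => (0 : ℝ)) θ) = f p θ) :
    InfGrassmannian.IsAsymmetricMetric (InfGrassmannian.asymExtension d) ∧
    ∀ V W : InfGrassmannian.FullGr 𝕜,
      (0 < V.dim → V.dim ≤ W.dim →
        (∃! θ : Fin V.dim → ℝ, InfGrassmannian.IsPrincipalAngles V.1 W.1 θ) ∧
        ∀ θ : Fin V.dim → ℝ, InfGrassmannian.IsPrincipalAngles V.1 W.1 θ →
          InfGrassmannian.asymExtension d V W = f V.dim θ) ∧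
      (¬ (0 < V.dim ∧ V.dim ≤ W.dim) →
        InfGrassmannian.asymExtension d V W = InfGrassmannian.diam (d V.dim)) := by

  open InfGrassmannian in
  refine ⟨⟨⟨⟨⊥, 0, bot_le⟩⟩, asymExtension_separation hd hmono hdf,
    asymExtension_triangle hd hmono hdf hpad⟩, fun V W => ⟨fun hV hVW => ⟨?_, fun θ hθ =>
    asymExtension_eq hmono hdf hV hθ⟩, fun h => ?_⟩⟩
  · obtain ⟨θ, hθ⟩ := exists_isPrincipalAngles (V := V.1) (W := W.1) rfl hVW
    exact ⟨θ, hθ, fun θ' hθ' => hθ'.unique hθ rfl⟩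
  · rcases Nat.eq_zero_or_pos V.dim with hV | hV
    -- In dimension zero the Grassmannian is a point, so both sides vanish.
    · rw [asymExtension_eq_zero_of_dim_eq_zero hd hV, hV, diam_zero hd]
    · exact asymExtension_eq_diam_of_lt (not_le.1 fun hVW => h ⟨hV, hVW⟩)
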